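/- For a nonzero real Laurent polynomial $f=\sum_{i=p}^{q}a_iX^i\in\mathbb{R}[X^{\pm}]$ with $a_p,a_q\neq 0$ put $\deg_-(f)=p$, $\deg_+(f)=q$, $\operatorname{lc}_-(f)=a_p$, $\operatorname{lc}_+(f)=a_q$; put $\deg_-(0)=+\infty$, $\deg_+(0)=-\infty$ and $\operatorname{lc}_\pm(0)=0$. For $n\ge 2$ write the elements of $\mathbb{R}[X^{\pm}]^n$ as $\boldsymbol f=(f_S,f_K,f_3,\dots,f_n)$ and let $\operatorname{lc}_*$ act coordinatewise. Let $F$ be a subfield of $\mathbb{R}$ with a computable presentation: every element of $F$ is named by at least one natural number, the field operations of $F$ are computable on names, and the order $\le$ is decidable on names (for example $F=\mathbb{Q}$, or the field of real algebraic numbers). **Proposition.** Let $*\in\{+,-\}$. There is an algorithm which, given as input integers $n\ge 2$ and $a$, and a finite list $\boldsymbol g_1,\dots,\boldsymbol g_m\in F[X^{\pm}]^n$ (each Laurent polynomial being written as a list of terms, i.e. pairs of an integer exponent and a name of a coefficient), decides whether the $\mathbb{R}[X^{\pm}]$-submodule $\mathcal M=\{\phi_1\boldsymbol g_1+\cdots+\phi_m\boldsymbol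 g_m \mid \phi_1,\dots,\phi_m\in\mathbb{R}[X^{\pm}]\}$ of $\mathbb{R}[X^{\pm}]^n$ contains an element $\boldsymbol f=(f_S,f_K,\dots)$ such that $$\operatorname{lc}_*(\boldsymbol f)\in\mathbb{R}_{>0}^n\quad\text{and}\quad \deg_*(f_S)+a\ge\deg_*(f_K).$$ -/

import Mathlib

open scoped LaurentPolynomial

namespace LaurentDecision

/-- The two ends of a Laurent polynomial: the symbol `* ∈ {+, -}`. -/
inductive Side where
  | pos
  | neg

/-- `deg₊`, the largest exponent of `f`, with `deg₊ 0 = -∞`. -/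
noncomputable def degPos (f : ℝ[T;T⁻¹]) : WithBot ℤ := f.coeff.support.max

/-- `deg₋`, the smallest exponent of `f`, with `deg₋ 0 = +∞`. -/
noncomputable def degNeg (f : ℝ[T;T⁻¹]) : WithTop ℤ := f.coeff.support.min

/-- `lc_*`, the coefficient of `f` at the exponent `deg_* f`, with `lc_* 0 = 0`. -/
noncomputable def lc (s : Side) (f : ℝ[T;T⁻¹]) : ℝ :=
  if h : f.coeff.support.Nonempty then
    match s with
    | Side.pos => f.coeff (f.coeff.support.max' h)
    | Side.neg => f.coeff (f.coeff.support.min' h)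
  else 0

/-- The inequality `deg_* f + a ≥ deg_* g`. -/
def DegLE (s : Side) (a : ℤ) (f g : ℝ[T;T⁻¹]) : Prop :=
  match s with
  | Side.pos => degPos f + (a : WithBot ℤ) ≥ degPos g
  | Side.neg => degNeg f + (a : WithTop ℤ) ≥ degNeg g

/-- Some `f = (f_S, f_K, f₃, …, f_n)` in `M` satisfies `lc_* f ∈ (ℝ_{>0})ⁿ` and
`deg_* f_S + a ≥ deg_* f_K`. Here `n = k + 2`; the coordinates `S`, `K` are `0`, `1`. -/
def HasSolution (s : Side) (a : ℤ) {k : ℕ}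
    (M : Submodule ℝ[T;T⁻¹] (Fin (k + 2) → ℝ[T;T⁻¹])) : Prop :=
  ∃ f ∈ M, (∀ i, 0 < lc s (f i)) ∧ DegLE s a (f 0) (f 1)

/-- `ν` names every element of the subfield `F` of `ℝ` by at least one natural number, in such a
way that the field operations are computable on names and the order is decidable on names. -/
structure IsComputableNumbering (F : Subfield ℝ) (ν : ℕ → F) : Prop where
  surjective : Function.Surjective ν
  add : ∃ p : ℕ × ℕ → ℕ, Computable p ∧ ∀ x y, ν (p (x, y)) = ν x + ν y
  neg : ∃ p : ℕ → ℕ, Computable p ∧ ∀ x, ν (p x) = -ν x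
  mul : ∃ p : ℕ × ℕ → ℕ, Computable p ∧ ∀ x y, ν (p (x, y)) = ν x * ν y
  inv : ∃ p : ℕ → ℕ, Computable p ∧ ∀ x, ν x ≠ 0 → ν (p x) = (ν x)⁻¹
  le : ComputablePred fun q : ℕ × ℕ => ν q.1 ≤ ν q.2

/-- A written Laurent polynomial: a finite list of terms (exponent, name of the coefficient). -/
abbrev PolyCode := List (ℤ × ℕ)

/-- A written tuple of Laurent polynomials: the list of its coordinates. -/
abbrev VecCode := List PolyCode

/-- An input: `k` (the tuples have `n = k + 2` coordinates), the integer `a`, and the list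
of the generators `g₁, …, g_m`. -/
abbrev Input := ℕ × ℤ × List VecCode

/-- The sum of the listed terms. -/
noncomputable def polyOf {F : Subfield ℝ} (ν : ℕ → F) (c : PolyCode) : ℝ[T;T⁻¹] :=
  (c.map fun t => LaurentPolynomial.C (ν t.2 : ℝ) * LaurentPolynomial.T t.1).sum

/-- The tuple with the listed coordinates. The conventions that make this total: coordinates
beyond the `n`-th are ignored, and missing ones are `0`. -/
noncomputable def vecOf {F : Subfield ℝ} (ν : ℕ → F) (n : ℕ) (v : VecCode) : Fin n → ℝ[T;T⁻¹] :=
  fun i => polyOf ν (v.getD i [])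

/-- The `ℝ[X^±]`-submodule of `ℝ[X^±]ⁿ` generated by the listed tuples. -/
noncomputable def moduleOf {F : Subfield ℝ} (ν : ℕ → F) (n : ℕ) (G : List VecCode) :
    Submodule ℝ[T;T⁻¹] (Fin n → ℝ[T;T⁻¹]) :=
  Submodule.span ℝ[T;T⁻¹] {g | ∃ v ∈ G, vecOf ν n v = g}

end LaurentDecision

/-! Substitute `X ↦ X^{±2}`, with the sign that moves the end `*` to the top. Of `f_S`, `f_K`, let
`large` be the coordinate whose outward degree `d` is bounded from below and `small` the one whose
outward degree `e` is bounded from above. The degree condition `e ≤ d + a` says `2e < 2d + 2a + 1`.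
Since both leading coefficients are positive, this means that `T^(2a+1) * large(T²) - small(T²)` has
positive leading coefficient; the odd shift rules out equal degrees. So the degree condition becomes
one more positivity condition, on a tuple with `n + 1` coordinates (`extend`).

The extended tuples are a module only over the even Laurent polynomials. Over all Laurent
polynomials they span the tuples `P + T * Q`, with `P`, `Q` extended from `p`, `q` in the module.
Nothing is gained by this enlargement: if `P + T * Q` is positive in every coordinate, then `p + c
q` with `c` large solves the problem, after multiplication by `T` if the degree of the `large`
coordinate is odd (`hasSolution_of_leadPos`).

Laurent polynomials over `F`, ordered by the sign of the leading coefficient, form an ordered ring,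
and Gordan's alternative holds there without division (`gordan`): either the span over `F` contains
a tuple with all coordinates positive, or a nonzero nonnegative tuple over `F` is orthogonal to all
generators. Such a tuple also excludes real solutions, so solvability over `ℝ` and over `F` agree
(`hasSolution_span_iff`). Both alternatives have finite certificates that can be checked on names,
and searching for both at once decides the question. -/

namespace LaurentDecision

/-! ### Gordan's alternative over an ordered commutative ring. -/

section Gordan

variable {R : Type*} [CommRing R] [LinearOrder R] [IsStrictOrderedRing R]

/-- Small multiples of the `q i` can be absorbed by a multiple of the positive `p i`. -/
theorem exists_pos_combination {ι : Type*} (s : Finset ι) (p q : ι → R) (hp : ∀ i ∈ s, 0 < p i) :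
    ∃ c u : R, 0 < c ∧ 0 < u ∧ ∀ i ∈ s, 0 < c * p i + u * q i := by
  classical
  induction s using Finset.induction_on with
  | empty => exact ⟨1, 1, one_pos, one_pos, by simp⟩
  | insert j s _ ih =>
    obtain ⟨c, u, hc, hu, h⟩ := ih fun i hi => hp i (Finset.mem_insert_of_mem hi)
    have hj := hp j (Finset.mem_insert_self j s)
    rcases le_or_gt 0 (q j) with hq | hq
    · refine ⟨c, u, hc, hu, fun i hi => ?_⟩
      rcases Finset.mem_insert.1 hi with rfl | hi
      · positivity
      · exact h i hi
    -- Scale the old pair by `p j` and add `u * (-q j)` to the first entry: at `j` the terms in `q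
    -- j` cancel and `c * p j * p j` remains.
    · refine ⟨c * p j + u * (-q j), u * p j, ?_, by positivity, fun i hi => ?_⟩
      · have := neg_pos.2 hq
        positivity
      rcases Finset.mem_insert.1 hi with rfl | hi
      · have : 0 < c * p i * p i := by positivity
        linarith
      · have h1 : 0 < p j * (c * p i + u * q i) := mul_pos hj (h i hi)
        have h2 : 0 < u * (-q j) * p i :=
          mul_pos (mul_pos hu (neg_pos.2 hq)) (hp i (Finset.mem_insert_of_mem hi))
        linarith

/-- Gordan's alternative over an ordered commutative ring: either finitely many linear functionals
are simultaneously positive somewhere, or a nontrivial nonnegative combination of them vanishes. -/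
theorem gordan {M ι : Type*} [AddCommGroup M] [Module R M] (s : Finset ι) (a : ι → M →ₗ[R] R) :
    (∃ x, ∀ i ∈ s, 0 < a i x) ∨
      ∃ y : ι → R, (∀ i ∈ s, 0 ≤ y i) ∧ (∃ i ∈ s, 0 < y i) ∧ ∑ i ∈ s, y i • a i = 0 := by
  classical
  induction s using Finset.induction_on generalizing a with
  | empty => exact Or.inl ⟨0, by simp⟩
  | insert j s hj ih =>
    have key : ∀ (t : R) (z : ι → R), 0 ≤ t → (∀ i ∈ s, 0 ≤ z i) → (0 < t ∨ ∃ i ∈ s, 0 < z i) →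
        t • a j + ∑ i ∈ s, z i • a i = 0 → ∃ y : ι → R, (∀ i ∈ insert j s, 0 ≤ y i) ∧
          (∃ i ∈ insert j s, 0 < y i) ∧ ∑ i ∈ insert j s, y i • a i = 0 := by
      intro t z ht hz hpos hsum
      have hne : ∀ i ∈ s, i ≠ j := fun i hi h => hj (h ▸ hi)
      refine ⟨fun i => if i = j then t else z i, fun i hi => ?_, ?_, ?_⟩
      · rcases Finset.mem_insert.1 hi with rfl | hi
        · simpa using ht
        · simpa [hne i hi] using hz i hi
      · rcases hpos with h | ⟨i, hi, h⟩
        · exact ⟨j, Finset.mem_insert_self j s, by simpa using h⟩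
        · exact ⟨i, Finset.mem_insert_of_mem hi, by simpa [hne i hi] using h⟩
      · rw [Finset.sum_insert hj, ← hsum]
        congr 1
        · simp
        · exact Finset.sum_congr rfl fun i hi => by simp [hne i hi]
    rcases ih a with ⟨x, hx⟩ | ⟨y, hy, hy', hsum⟩
    swap
    · exact Or.inr (key 0 y le_rfl hy (Or.inr hy') (by simpa using hsum))
    rcases lt_or_ge 0 (a j x) with hjx | hjx
    · refine Or.inl ⟨x, fun i hi => ?_⟩
      rcases Finset.mem_insert.1 hi with rfl | hi
      exacts [hjx, hx i hi]
    by_cases hb : a j = 0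
    · exact Or.inr (key 1 0 zero_le_one (by simp) (Or.inl one_pos) (by simp [hb]))
    -- Moving `χ` slightly along `a j θ • θ` makes `a j` positive, its value there being a square.
    -- Without division, "slightly" means that `χ` is scaled up as well.
    have perturb : ∀ χ : M, a j χ = 0 → (∀ i ∈ s, 0 < a i χ) → ∃ x, ∀ i ∈ insert j s, 0 < a i x := by
      intro χ hχ hpos
      obtain ⟨θ, hθ⟩ : ∃ θ, a j θ ≠ 0 := by
        by_contra! h
        exact hb (LinearMap.ext h)
      obtain ⟨c, u, hc, hu, h⟩ :=
        exists_pos_combination s (fun i => a i χ) (fun i => a i (a j θ • θ)) hpos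
      refine ⟨c • χ + u • a j θ • θ, fun i hi => ?_⟩
      rcases Finset.mem_insert.1 hi with rfl | hi
      · have : 0 < a i θ * a i θ := mul_self_pos.2 hθ
        simpa [hχ] using mul_pos hu this
      · simpa using h i hi
    rcases hjx.lt_or_eq with hjx | hjx
    swap
    · exact Or.inl (perturb x hjx hx)
    -- Eliminate `a j`: these functionals vanish at `x`. A point `ψ` where they are positive can be
    -- corrected by a multiple of `x` into the kernel of `a j`; a relation among them expands to one
    -- among the original functionals.
    rcases ih fun i => a i x • a j + (-a j x) • a i with ⟨ψ, hψ⟩ | ⟨y, hy, ⟨i, hi, hyi⟩, hsum⟩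
    · refine Or.inl (perturb ((-a j x) • ψ + a j ψ • x) ?_ fun i hi => ?_)
      · simp; ring
      · have := hψ i hi
        simp at this ⊢
        linarith
    · refine Or.inr (key (∑ i ∈ s, y i * a i x) (fun i => y i * -a j x)
        (Finset.sum_nonneg fun i hi => mul_nonneg (hy i hi) (hx i hi).le)
        (fun i hi => mul_nonneg (hy i hi) (neg_pos.2 hjx).le)
        (Or.inr ⟨i, hi, mul_pos hyi (neg_pos.2 hjx)⟩) ?_)
      rw [← hsum, Finset.sum_smul, ← Finset.sum_add_distrib]
      exact Finset.sum_congr rfl fun i _ => by simp only [smul_add, smul_smul]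

end Gordan

end LaurentDecision

namespace LaurentDecision

/-! ### The order of Laurent polynomials by leading coefficient. -/

section Order

variable {K : Type*} [Field K] [LinearOrder K] [IsStrictOrderedRing K]

/-- `f` has positive leading coefficient at the top exponent `d`. -/
def IsLead (f : K[T;T⁻¹]) (d : ℤ) : Prop :=
  0 < f.coeff d ∧ ∀ e, d < e → f.coeff e = 0

/-- The leading coefficient of `f` is positive. -/
def LeadPos (f : K[T;T⁻¹]) : Prop := ∃ d, IsLead f d

omit [IsStrictOrderedRing K] in
theorem IsLead.eq {f : K[T;T⁻¹]} {d e : ℤ} (hd : IsLead f d) (he : IsLead f e) : d = e := by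
  rcases lt_trichotomy d e with h | h | h
  · exact absurd (hd.2 e h) he.1.ne'
  · exact h
  · exact absurd (he.2 d h) hd.1.ne'

omit [IsStrictOrderedRing K] in
theorem not_leadPos_zero : ¬ LeadPos (0 : K[T;T⁻¹]) := by
  rintro ⟨d, hd, -⟩
  simp at hd

omit [IsStrictOrderedRing K] in
theorem IsLead.add_of_lt {f g : K[T;T⁻¹]} {d : ℤ} (hf : IsLead f d)
    (hg : ∀ e, d ≤ e → g.coeff e = 0) : IsLead (f + g) d := by
  refine ⟨?_, fun e he => ?_⟩
  · simpa [hg d le_rfl] using hf.1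
  · simp [hf.2 e he, hg e he.le]

theorem LeadPos.add {f g : K[T;T⁻¹]} (hf : LeadPos f) (hg : LeadPos g) : LeadPos (f + g) := by
  obtain ⟨d, hd⟩ := hf
  obtain ⟨e, he⟩ := hg
  rcases lt_trichotomy d e with h | h | h
  · rw [add_comm]
    exact ⟨e, he.add_of_lt fun x hx => hd.2 x (h.trans_le hx)⟩
  · subst h
    refine ⟨d, ?_, fun x hx => ?_⟩
    · simpa using add_pos hd.1 he.1
    · simp [hd.2 x hx, he.2 x hx]
  · exact ⟨d, hd.add_of_lt fun x hx => he.2 x (h.trans_le hx)⟩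

theorem IsLead.mul {f g : K[T;T⁻¹]} {d e : ℤ} (hf : IsLead f d) (hg : IsLead g e) :
    IsLead (f * g) (d + e) := by
  have hcoeff : ∀ x, (f * g).coeff x = f.coeff.sum fun m r => r * g.coeff (-m + x) := fun x =>
    AddMonoidAlgebra.coeff_mul_apply_left f g x
  refine ⟨?_, fun x hx => ?_⟩
  · rw [hcoeff, Finsupp.sum, Finset.sum_eq_single d]
    · simpa using mul_pos hf.1 hg.1
    · intro m _ hm
      rcases lt_or_gt_of_ne hm with h | h
      · rw [hg.2 _ (by linarith), mul_zero]
      · rw [hf.2 _ h, zero_mul]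
    · intro hd
      exact absurd hf.1 (by simp [Finsupp.notMem_support_iff.1 hd])
  · rw [hcoeff, Finsupp.sum]
    refine Finset.sum_eq_zero fun m _ => ?_
    rcases lt_or_ge d m with h | h
    · rw [hf.2 _ h, zero_mul]
    · rw [hg.2 _ (by linarith), mul_zero]

theorem LeadPos.mul {f g : K[T;T⁻¹]} (hf : LeadPos f) (hg : LeadPos g) : LeadPos (f * g) := by
  obtain ⟨d, hd⟩ := hf
  obtain ⟨e, he⟩ := hg
  exact ⟨_, hd.mul he⟩

theorem isLead_T (n : ℤ) : IsLead (LaurentPolynomial.T n : K[T;T⁻¹]) n :=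
  ⟨by simp, fun e he => by simp [he.ne]⟩

theorem leadPos_trichotomy (f : K[T;T⁻¹]) : f = 0 ∨ LeadPos f ∨ LeadPos (-f) := by
  by_cases hf : f = 0
  · exact Or.inl hf
  have hne : f.coeff.support.Nonempty := by
    rwa [Finsupp.support_nonempty_iff, Ne, AddMonoidAlgebra.coeff_eq_zero]
  set d := f.coeff.support.max' hne with hd
  have h0 : f.coeff d ≠ 0 := Finsupp.mem_support_iff.1 (Finset.max'_mem _ hne)
  have h1 : ∀ e, d < e → f.coeff e = 0 := fun e he => by
    by_contra h
    exact (Finset.le_max' _ e (Finsupp.mem_support_iff.2 h)).not_gt he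
  rcases lt_or_gt_of_ne h0 with h | h
  · exact Or.inr (Or.inr ⟨d, by simpa using h, fun e he => by simp [h1 e he]⟩)
  · exact Or.inr (Or.inl ⟨d, h, h1⟩)

/-- The cone of the Laurent polynomials that are `0` or have positive leading coefficient. -/
def leadCone (K : Type*) [Field K] [LinearOrder K] [IsStrictOrderedRing K] :
    RingCone K[T;T⁻¹] where
  carrier := {f | f = 0 ∨ LeadPos f}
  mul_mem' := by
    rintro f g (rfl | hf) (rfl | hg)
    · simp
    · simp
    · simp
    · exact Or.inr (hf.mul hg)
  one_mem' := Or.inr ⟨0, by simpa using isLead_T (K := K) 0⟩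
  add_mem' := by
    rintro f g (rfl | hf) (rfl | hg)
    · simp
    · simpa using Or.inr hg
    · simpa using Or.inr hf
    · exact Or.inr (hf.add hg)
  zero_mem' := Or.inl rfl
  eq_zero_of_mem_of_neg_mem' := by
    rintro f (rfl | hf) (hf' | hf')
    · rfl
    · rfl
    · simpa using hf'
    · exact absurd (hf.add hf') (by simpa using not_leadPos_zero)

/-- The order of Laurent polynomials by their values near `+∞`. -/
@[reducible] noncomputable def leadOrder (K : Type*) [Field K] [LinearOrder K]
    [IsStrictOrderedRing K] : LinearOrder K[T;T⁻¹] :=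
  haveI : HasMemOrNegMem (leadCone K) := ⟨fun f => by
    rcases leadPos_trichotomy f with h | h | h
    exacts [Or.inl (Or.inl h), Or.inl (Or.inr h), Or.inr (Or.inr h)]⟩
  letI : DecidablePred (· ∈ leadCone K) := Classical.decPred _
  .mkOfAddGroupCone (leadCone K)

theorem leadOrder_le_iff (f g : K[T;T⁻¹]) :
    (leadOrder K).le f g ↔ g - f = 0 ∨ LeadPos (g - f) := Iff.rfl

theorem leadOrder_isStrictOrderedRing :
    letI := leadOrder K
    IsStrictOrderedRing K[T;T⁻¹] :=
  letI := leadOrder K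
  haveI : IsOrderedRing K[T;T⁻¹] := .mkOfCone (leadCone K)
  inferInstance

theorem leadOrder_nonneg_iff (f : K[T;T⁻¹]) :
    (letI := leadOrder K; 0 ≤ f) ↔ f = 0 ∨ LeadPos f := by
  have := leadOrder_le_iff 0 f
  simpa using this

theorem leadOrder_pos_iff (f : K[T;T⁻¹]) : (letI := leadOrder K; 0 < f) ↔ LeadPos f := by
  let := leadOrder K
  rw [lt_iff_le_and_ne]
  have := leadOrder_nonneg_iff f
  constructor
  · rintro ⟨h, hne⟩
    exact (this.1 h).resolve_left (Ne.symm hne)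
  · intro h
    refine ⟨this.2 (Or.inr h), ?_⟩
    rintro rfl
    exact not_leadPos_zero h

theorem leadPos_sum {ι : Type*} (s : Finset ι) (f : ι → K[T;T⁻¹])
    (h : ∀ i ∈ s, f i = 0 ∨ LeadPos (f i)) (h' : ∃ i ∈ s, LeadPos (f i)) :
    LeadPos (∑ i ∈ s, f i) := by
  let := leadOrder K
  have := leadOrder_isStrictOrderedRing (K := K)
  refine (leadOrder_pos_iff _).1 (Finset.sum_pos' (fun i hi => (leadOrder_nonneg_iff _).2 (h i hi)) ?_)
  obtain ⟨i, hi, hp⟩ := h'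
  exact ⟨i, hi, (leadOrder_pos_iff _).2 hp⟩

/-- Gordan's alternative for a submodule of tuples of Laurent polynomials. -/
theorem exists_leadPos_or_exists_relation {N : ℕ} (S : Submodule K[T;T⁻¹] (Fin N → K[T;T⁻¹])) :
    (∃ f ∈ S, ∀ i, LeadPos (f i)) ∨
      ∃ y : Fin N → K[T;T⁻¹], (∀ i, y i = 0 ∨ LeadPos (y i)) ∧ (∃ i, LeadPos (y i)) ∧
        ∀ f ∈ S, ∑ i, y i * f i = 0 := by
  let := leadOrder K
  have := leadOrder_isStrictOrderedRing (K := K)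
  rcases gordan Finset.univ fun i : Fin N => LinearMap.proj i ∘ₗ S.subtype with
    ⟨x, hx⟩ | ⟨y, hy, ⟨i, -, hi⟩, hsum⟩
  · exact Or.inl ⟨x, x.2, fun i => (leadOrder_pos_iff _).1 (hx i (Finset.mem_univ i))⟩
  · refine Or.inr ⟨y, fun i => (leadOrder_nonneg_iff _).1 (hy i (Finset.mem_univ i)),
      ⟨i, (leadOrder_pos_iff _).1 hi⟩, fun f hf => ?_⟩
    simpa using LinearMap.congr_fun hsum ⟨f, hf⟩

/-- The two alternatives exclude each other: the sum has nonnegative terms, at least one of them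
positive. -/
theorem not_exists_leadPos_of_relation {N : ℕ} (f y : Fin N → K[T;T⁻¹])
    (hf : ∀ i, LeadPos (f i)) (hy : ∀ i, y i = 0 ∨ LeadPos (y i)) (hy' : ∃ i, LeadPos (y i)) :
    ∑ i, y i * f i ≠ 0 := by
  intro h
  refine not_leadPos_zero (K := K) (h ▸ leadPos_sum _ _ (fun i _ => ?_) ?_)
  · rcases hy i with h | h
    · exact Or.inl (by simp [h])
    · exact Or.inr (h.mul (hf i))
  · obtain ⟨i, hi⟩ := hy'
    exact ⟨i, Finset.mem_univ i, hi.mul (hf i)⟩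

end Order

end LaurentDecision

namespace LaurentDecision

/-! ### Outermost exponents towards either end. -/

open LaurentPolynomial (C T)

namespace Side

/-- The sign of the exponents in the direction of the end `s`. -/
def sgn : Side → ℤ
  | pos => 1
  | neg => -1

/-- The coordinate whose degree towards the end `s` is bounded from below by `DegLE`. -/
def large {k : ℕ} : Side → Fin (k + 2)
  | pos => 0
  | neg => 1

/-- The coordinate whose degree towards the end `s` is bounded from above by `DegLE`. -/
def small {k : ℕ} : Side → Fin (k + 2)
  | pos => 1
  | neg => 0

theorem sgn_mul_sgn_mul (s : Side) (e : ℤ) : s.sgn * (s.sgn * e) = e := by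
  cases s <;> simp [sgn]

end Side

/-- `f` has positive coefficient at its outermost exponent `sgn s * d` towards the end `s`. -/
def IsEnd (s : Side) (f : ℝ[T;T⁻¹]) (d : ℤ) : Prop :=
  0 < f.coeff (s.sgn * d) ∧ ∀ e, d < e → f.coeff (s.sgn * e) = 0

theorem IsEnd.ne_zero {s : Side} {f : ℝ[T;T⁻¹]} {d : ℤ} (h : IsEnd s f d) : f ≠ 0 := by
  rintro rfl
  simpa using h.1

theorem IsEnd.max {f : ℝ[T;T⁻¹]} {d : ℤ} (h : IsEnd Side.pos f d) :
    f.coeff.support.max = (d : WithBot ℤ) := by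
  simp only [IsEnd, Side.sgn, one_mul] at h
  refine le_antisymm (Finset.max_le fun e he => ?_) (Finset.le_max (by simpa using h.1.ne'))
  by_contra hlt
  exact Finsupp.mem_support_iff.1 he (h.2 e (by simpa using hlt))

theorem IsEnd.min {f : ℝ[T;T⁻¹]} {d : ℤ} (h : IsEnd Side.neg f d) :
    f.coeff.support.min = ((-d : ℤ) : WithTop ℤ) := by
  simp only [IsEnd, Side.sgn, neg_mul, one_mul] at h
  refine le_antisymm (Finset.min_le (by simpa using h.1.ne')) (Finset.le_min fun e he => ?_)
  by_contra hlt
  have hlt : e < -d := WithTop.coe_lt_coe.1 (not_le.1 hlt)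
  exact Finsupp.mem_support_iff.1 he (by simpa using h.2 (-e) (by linarith))

theorem lc_pos_iff (s : Side) (f : ℝ[T;T⁻¹]) : 0 < lc s f ↔ ∃ d, IsEnd s f d := by
  constructor
  · intro h
    unfold lc at h
    split_ifs at h with hne
    · cases s with
      | pos =>
        refine ⟨f.coeff.support.max' hne, by simpa [Side.sgn] using h, fun e he => ?_⟩
        by_contra h0
        exact (Finset.le_max' _ e (by simpa [Side.sgn] using h0)).not_gt he
      | neg =>
        refine ⟨-f.coeff.support.min' hne, by simpa [Side.sgn] using h, fun e he => ?_⟩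
        by_contra h0
        have := Finset.min'_le _ (-e) (Finsupp.mem_support_iff.2 (by simpa [Side.sgn] using h0))
        linarith
    · exact absurd h (lt_irrefl 0)
  · rintro ⟨d, hd⟩
    have hne : f.coeff.support.Nonempty := by
      rw [Finsupp.support_nonempty_iff, Ne, AddMonoidAlgebra.coeff_eq_zero]
      exact hd.ne_zero
    unfold lc
    rw [dif_pos hne]
    cases s with
    | pos =>
      have : f.coeff.support.max' hne = d := by
        have := hd.max
        rw [← Finset.coe_max' hne] at this
        exact_mod_cast this
      simpa [this, Side.sgn] using hd.1
    | neg =>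
      have : f.coeff.support.min' hne = -d := by
        have := hd.min
        rw [← Finset.coe_min' hne] at this
        exact_mod_cast this
      simpa [this, Side.sgn] using hd.1

/-- At the lower end the outward degree is `-deg₋`, which reverses the inequality; `large` and
`small` exchange coordinates to compensate. -/
theorem degLE_iff {k : ℕ} (s : Side) (a : ℤ) (f : Fin (k + 2) → ℝ[T;T⁻¹]) {d e : ℤ}
    (hd : IsEnd s (f s.large) d) (he : IsEnd s (f s.small) e) :
    DegLE s a (f 0) (f 1) ↔ e ≤ d + a := by
  cases s with
  | pos =>
    simp only [Side.large, Side.small] at hd he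
    simp only [DegLE, degPos, hd.max, he.max, ge_iff_le]
    exact_mod_cast Iff.rfl
  | neg =>
    simp only [Side.large, Side.small] at hd he
    simp only [DegLE, degNeg, hd.min, he.min, ge_iff_le]
    rw [← WithTop.coe_add, WithTop.coe_le_coe]
    constructor <;> intro h <;> linarith

/-! ### Doubling the exponents. -/

/-- Substitution of the square of the variable, inverted if `s = -`. -/
noncomputable def substSq (s : Side) : ℝ[T;T⁻¹] →+* ℝ[T;T⁻¹] :=
  AddMonoidAlgebra.mapDomainRingHom ℝ (AddMonoidHom.mulLeft (2 * s.sgn))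

theorem substSq_C_mul_T (s : Side) (c : ℝ) (n : ℤ) :
    substSq s (C c * T n) = C c * T (2 * s.sgn * n) := by
  rw [← LaurentPolynomial.single_eq_C_mul_T, ← LaurentPolynomial.single_eq_C_mul_T]
  exact AddMonoidAlgebra.mapDomain_single

theorem substSq_T (s : Side) (n : ℤ) : substSq s (T n) = T (2 * s.sgn * n) := by
  simpa using substSq_C_mul_T s 1 n

theorem coeff_substSq_even (s : Side) (f : ℝ[T;T⁻¹]) (e : ℤ) :
    (substSq s f).coeff (2 * e) = f.coeff (s.sgn * e) := by
  induction f using LaurentPolynomial.induction_on' with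
  | add p q hp hq => simp [hp, hq]
  | C_mul_T n c =>
    rw [substSq_C_mul_T, ← LaurentPolynomial.single_eq_C_mul_T,
      ← LaurentPolynomial.single_eq_C_mul_T, AddMonoidAlgebra.coeff_single,
      AddMonoidAlgebra.coeff_single, Finsupp.single_apply, Finsupp.single_apply]
    have : 2 * s.sgn * n = 2 * e ↔ n = s.sgn * e := by
      cases s <;> simp only [Side.sgn] <;> constructor <;> intro h <;> linarith
    simp only [this]

theorem coeff_substSq_odd (s : Side) (f : ℝ[T;T⁻¹]) (e : ℤ) :
    (substSq s f).coeff (2 * e + 1) = 0 := by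
  induction f using LaurentPolynomial.induction_on' with
  | add p q hp hq => simp [hp, hq]
  | C_mul_T n c =>
    rw [substSq_C_mul_T, ← LaurentPolynomial.single_eq_C_mul_T, AddMonoidAlgebra.coeff_single,
      Finsupp.single_apply, if_neg]
    rw [mul_assoc]
    omega

theorem coeff_T_mul (n : ℤ) (f : ℝ[T;T⁻¹]) (e : ℤ) : (T n * f).coeff e = f.coeff (e - n) := by
  have := AddMonoidAlgebra.coeff_single_mul_apply f (1 : ℝ) n e
  rw [one_mul] at this
  rw [show (T n : ℝ[T;T⁻¹]) = .single n 1 from rfl, this, neg_add_eq_sub]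

theorem IsEnd.substSq {s : Side} {f : ℝ[T;T⁻¹]} {d : ℤ} (h : IsEnd s f d) :
    IsLead (substSq s f) (2 * d) := by
  refine ⟨by simpa [coeff_substSq_even] using h.1, fun e he => ?_⟩
  obtain ⟨m, rfl | rfl⟩ := Int.even_or_odd' e
  · rw [coeff_substSq_even]
    exact h.2 m (by linarith)
  · exact coeff_substSq_odd s f m

theorem exists_even_add_odd (s : Side) (f : ℝ[T;T⁻¹]) :
    ∃ p q, f = substSq s p + T 1 * substSq s q := by
  induction f using LaurentPolynomial.induction_on' with
  | add f g hf hg =>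
    obtain ⟨p, q, rfl⟩ := hf
    obtain ⟨p', q', rfl⟩ := hg
    exact ⟨p + p', q + q', by simp only [map_add]; ring⟩
  | C_mul_T n c =>
    have hs : ∀ m, 2 * s.sgn * (s.sgn * m) = 2 * m := fun m => by
      rw [mul_assoc, s.sgn_mul_sgn_mul]
    obtain ⟨m, rfl | rfl⟩ := Int.even_or_odd' n
    · exact ⟨C c * T (s.sgn * m), 0, by simp only [substSq_C_mul_T, hs, map_zero]; ring⟩
    · refine ⟨0, C c * T (s.sgn * m), ?_⟩
      simp only [substSq_C_mul_T, hs, map_zero, LaurentPolynomial.T_add]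
      ring

/-! ### The degree condition as an additional positivity condition. -/

/-- The coordinates of `f` after `substSq`, preceded by a Laurent polynomial whose leading
coefficient is positive only if the degree condition holds up to rounding. -/
noncomputable def extend (s : Side) (a : ℤ) {k : ℕ} (f : Fin (k + 2) → ℝ[T;T⁻¹]) :
    Fin (k + 3) → ℝ[T;T⁻¹] :=
  Fin.cons (T (2 * a + 1) * substSq s (f s.large) - substSq s (f s.small))
    fun i => substSq s (f i)

section extend

variable (s : Side) (a : ℤ) {k : ℕ}

theorem extend_zero (f : Fin (k + 2) → ℝ[T;T⁻¹]) :
    extend s a f 0 = T (2 * a + 1) * substSq s (f s.large) - substSq s (f s.small) := rfl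

theorem extend_succ (f : Fin (k + 2) → ℝ[T;T⁻¹]) (i : Fin (k + 2)) :
    extend s a f i.succ = substSq s (f i) := rfl

theorem extend_map_zero : extend s a (0 : Fin (k + 2) → ℝ[T;T⁻¹]) = 0 := by
  funext i
  cases i using Fin.cases <;> simp [extend_zero, extend_succ]

theorem extend_add (f g : Fin (k + 2) → ℝ[T;T⁻¹]) :
    extend s a (f + g) = extend s a f + extend s a g := by
  funext i
  cases i using Fin.cases
  · simp [extend_zero]
    ring
  · simp [extend_succ]

theorem extend_smul (p : ℝ[T;T⁻¹]) (f : Fin (k + 2) → ℝ[T;T⁻¹]) :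
    extend s a (p • f) = substSq s p • extend s a f := by
  funext i
  cases i using Fin.cases
  · simp [extend_zero]
    ring
  · simp [extend_succ]

variable {s a}

theorem leadPos_extend {f : Fin (k + 2) → ℝ[T;T⁻¹]} (hf : ∀ i, 0 < lc s (f i))
    (h : DegLE s a (f 0) (f 1)) (i : Fin (k + 3)) : LeadPos (extend s a f i) := by
  have hf' := fun i => (lc_pos_iff s (f i)).1 (hf i)
  cases i using Fin.cases with
  | zero =>
    obtain ⟨d, hd⟩ := hf' s.large
    obtain ⟨e, he⟩ := hf' s.small
    have hde := (degLE_iff s a f hd he).1 h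
    rw [extend_zero, sub_eq_add_neg]
    refine ⟨_, ((isLead_T (2 * a + 1)).mul hd.substSq).add_of_lt fun x hx => ?_⟩
    simp [he.substSq.2 x (by linarith)]
  | succ i =>
    obtain ⟨d, hd⟩ := hf' i
    exact ⟨_, hd.substSq⟩

/-- The coefficients of `f` sit at the even exponents and those of `g` at the odd ones. If `d = 2m`,
then `g` has no coefficient at `m` and any `c` works; if `d = 2m + 1`, the coefficient of `g` at `m`
is positive and dominates for large `c`. -/
theorem eventually_isEnd {f g : ℝ[T;T⁻¹]} {d : ℤ}
    (h : IsLead (substSq s f + T 1 * substSq s g) d) :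
    ∀ᶠ c : ℝ in Filter.atTop, IsEnd s (f + C c * g) (d / 2) := by
  have hf : ∀ e, (substSq s f + T 1 * substSq s g).coeff (2 * e) = f.coeff (s.sgn * e) := fun e => by
    have := coeff_substSq_odd s g (e - 1)
    rw [show 2 * (e - 1) + 1 = 2 * e - 1 by ring] at this
    simp only [AddMonoidAlgebra.coeff_add, Finsupp.add_apply, coeff_T_mul, coeff_substSq_even, this,
      add_zero]
  have hg : ∀ e, (substSq s f + T 1 * substSq s g).coeff (2 * e + 1) = g.coeff (s.sgn * e) :=
    fun e => by
      simp only [AddMonoidAlgebra.coeff_add, Finsupp.add_apply, coeff_T_mul, coeff_substSq_odd,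
        add_sub_cancel_right, coeff_substSq_even, zero_add]
  have hc : ∀ (c : ℝ) e, (f + C c * g).coeff e = f.coeff e + c * g.coeff e := fun c e => by
    rw [← LaurentPolynomial.smul_eq_C_mul]
    simp
  simp only [IsEnd, hc]
  obtain ⟨m, rfl | rfl⟩ := Int.even_or_odd' d
  · refine Filter.Eventually.of_forall fun c => ?_
    rw [show 2 * m / 2 = m by omega]
    refine ⟨?_, fun e he => ?_⟩
    · rw [← hf, ← hg, h.2 (2 * m + 1) (by linarith)]
      simpa using h.1
    · rw [← hf, ← hg, h.2 _ (by linarith), h.2 _ (by linarith)]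
      simp
  · rw [show (2 * m + 1) / 2 = m by omega]
    have hpos : 0 < g.coeff (s.sgn * m) := by
      rw [← hg]
      exact h.1
    filter_upwards [Filter.eventually_gt_atTop (-f.coeff (s.sgn * m) / g.coeff (s.sgn * m))]
      with c hc'
    refine ⟨?_, fun e he => ?_⟩
    · rw [div_lt_iff₀ hpos] at hc'
      linarith
    · rw [← hf, ← hg, h.2 _ (by linarith), h.2 _ (by linarith)]
      simp

theorem exists_solution_of_even {f g : Fin (k + 2) → ℝ[T;T⁻¹]} {m : ℤ}
    (h : ∀ i, LeadPos (extend s a f i + T 1 * extend s a g i))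
    (hm : IsLead (extend s a f s.large.succ + T 1 * extend s a g s.large.succ) (2 * m)) :
    ∃ c : ℝ, (∀ i, 0 < lc s ((f + (C c : ℝ[T;T⁻¹]) • g) i)) ∧
      DegLE s a ((f + (C c : ℝ[T;T⁻¹]) • g) 0) ((f + (C c : ℝ[T;T⁻¹]) • g) 1) := by
  choose d hd using fun i : Fin (k + 2) => h i.succ
  obtain ⟨c, hc⟩ := (Filter.eventually_all.2 fun i => eventually_isEnd (hd i)).exists
  refine ⟨c, fun i => (lc_pos_iff _ _).2 ⟨_, hc i⟩,
    (degLE_iff s a (f + (C c : ℝ[T;T⁻¹]) • g) (hc s.large) (hc s.small)).2 ?_⟩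
  have hlarge : d s.large = 2 * m := (hd s.large).eq hm
  -- As `d s.large` is even, halving and rounding down absorbs the extra `1`; for odd `d s.large`
  -- this would fail.
  suffices d s.small ≤ d s.large + (2 * a + 1) by omega
  by_contra! hlt
  obtain ⟨x, hx⟩ := h 0
  -- Otherwise the `small` term would dominate and make coordinate `0` negative.
  have h0 : extend s a f 0 + T 1 * extend s a g 0 =
      -((extend s a f s.small.succ + T 1 * extend s a g s.small.succ) +
        -(T (2 * a + 1) * (extend s a f s.large.succ + T 1 * extend s a g s.large.succ))) := by
    simp only [extend_zero, extend_succ]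
    ring
  have hneg := (hd s.small).add_of_lt
    (g := -(T (2 * a + 1) * (extend s a f s.large.succ + T 1 * extend s a g s.large.succ)))
    fun e he => by
      simp only [AddMonoidAlgebra.coeff_neg, Finsupp.neg_apply, coeff_T_mul]
      rw [(hd s.large).2 _ (by linarith), neg_zero]
  refine not_leadPos_zero (K := ℝ) ?_
  have := LeadPos.add (h 0) ⟨_, hneg⟩
  rwa [h0, neg_add_cancel] at this

theorem hasSolution_of_leadPos {M : Submodule ℝ[T;T⁻¹] (Fin (k + 2) → ℝ[T;T⁻¹])}
    {f g : Fin (k + 2) → ℝ[T;T⁻¹]} (hf : f ∈ M) (hg : g ∈ M)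
    (h : ∀ i, LeadPos (extend s a f i + T 1 * extend s a g i)) : HasSolution s a M := by
  obtain ⟨d, hd⟩ := h s.large.succ
  obtain ⟨m, rfl | rfl⟩ := Int.even_or_odd' d
  · obtain ⟨c, hc⟩ := exists_solution_of_even h hd
    exact ⟨_, M.add_mem hf (M.smul_mem _ hg), hc⟩
  -- Multiplying by `T` makes the degree even and exchanges the roles of `f` and `g`: the factor
  -- `T²` now on `g` is the image of `T s.sgn` under `substSq s`.
  · have key : ∀ i, extend s a ((T s.sgn : ℝ[T;T⁻¹]) • g) i + T 1 * extend s a f i =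
        T 1 * (extend s a f i + T 1 * extend s a g i) := fun i => by
      have h2 : 2 * s.sgn * s.sgn = 1 + 1 := by cases s <;> simp [Side.sgn]
      rw [extend_smul, substSq_T, h2, LaurentPolynomial.T_add]
      simp only [Pi.smul_apply, smul_eq_mul]
      ring
    obtain ⟨c, hc⟩ := exists_solution_of_even (s := s) (a := a) (f := (T s.sgn : ℝ[T;T⁻¹]) • g)
      (g := f) (m := m + 1)
      (fun i => by rw [key]; exact LeadPos.mul ⟨_, isLead_T 1⟩ (h i))
      (by
        rw [key]
        have := (isLead_T (K := ℝ) 1).mul hd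
        rwa [show 1 + (2 * m + 1) = 2 * (m + 1) by ring] at this)
    exact ⟨_, M.add_mem (M.smul_mem _ hg) (M.smul_mem _ hf), hc⟩

end extend

/-! ### Descent from real coefficients to the subfield. -/

section Subfield

variable {F : Subfield ℝ}

/-- The inclusion of the Laurent polynomials over `F` into those over `ℝ`. -/
noncomputable def toReal (F : Subfield ℝ) : F[T;T⁻¹] →+* ℝ[T;T⁻¹] :=
  AddMonoidAlgebra.mapRingHom ℤ F.subtype

theorem coeff_toReal (f : F[T;T⁻¹]) (e : ℤ) : (toReal F f).coeff e = (f.coeff e : ℝ) := by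
  simp [toReal]

theorem leadPos_toReal {f : F[T;T⁻¹]} (h : LeadPos f) : LeadPos (toReal F f) := by
  obtain ⟨d, h1, h2⟩ := h
  refine ⟨d, ?_, fun e he => ?_⟩
  · rw [coeff_toReal]
    exact_mod_cast h1
  · rw [coeff_toReal, h2 e he]
    simp

theorem hasSolution_span_iff (s : Side) (a : ℤ) {k : ℕ} (B : Set (Fin (k + 2) → ℝ[T;T⁻¹]))
    (B' : Set (Fin (k + 3) → F[T;T⁻¹]))
    (h : ∀ g' ∈ B', ∃ g ∈ B, ∀ i, toReal F (g' i) = extend s a g i)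
    (h' : ∀ g ∈ B, ∃ g' ∈ B', ∀ i, toReal F (g' i) = extend s a g i) :
    HasSolution s a (Submodule.span ℝ[T;T⁻¹] B) ↔
      ∃ f ∈ Submodule.span F[T;T⁻¹] B', ∀ i, LeadPos (f i) := by
  constructor
  · rintro ⟨f, hf, hpos, hdeg⟩
    -- A relation over `F` that obstructs solutions over `F` stays nonnegative and orthogonal to the
    -- generators over `ℝ`, so it would contradict the given real solution.
    refine (exists_leadPos_or_exists_relation _).resolve_right ?_
    rintro ⟨y, hy, ⟨j, hj⟩, hrel⟩
    refine not_exists_leadPos_of_relation (extend s a f) (fun i => toReal F (y i))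
      (leadPos_extend hpos hdeg) (fun i => ?_) ⟨j, leadPos_toReal hj⟩ ?_
    · rcases hy i with h | h
      · exact Or.inl (by simp [h])
      · exact Or.inr (leadPos_toReal h)
    · clear hpos hdeg
      induction hf using Submodule.span_induction with
      | mem g hg =>
        obtain ⟨g', hg', heq⟩ := h' g hg
        simpa [heq] using congrArg (toReal F) (hrel g' (Submodule.subset_span hg'))
      | zero => simp [extend_map_zero]
      | add f g _ _ hf hg => simp [extend_add, mul_add, Finset.sum_add_distrib, hf, hg]
      | smul p f _ hf =>
        simp only [extend_smul, Pi.smul_apply, smul_eq_mul, mul_left_comm _ (substSq s p)]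
        rw [← Finset.mul_sum, hf, mul_zero]
  · rintro ⟨f, hf, hpos⟩
    -- The tuples of this form are closed under all scalars: split a scalar into even and odd parts
    -- and use that `T²` lies in the image of `substSq s`.
    obtain ⟨p, hp, q, hq, hpq⟩ : ∃ p ∈ Submodule.span ℝ[T;T⁻¹] B, ∃ q ∈ Submodule.span ℝ[T;T⁻¹] B,
        ∀ i, toReal F (f i) = extend s a p i + T 1 * extend s a q i := by
      clear hpos
      induction hf using Submodule.span_induction with
      | mem g hg =>
        obtain ⟨g', hg', heq⟩ := h g hg
        exact ⟨g', Submodule.subset_span hg', 0, zero_mem _, fun i => by simp [heq, extend_map_zero]⟩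
      | zero => exact ⟨0, zero_mem _, 0, zero_mem _, fun i => by simp [extend_map_zero]⟩
      | add f g _ _ hf hg =>
        obtain ⟨p, hp, q, hq, hf⟩ := hf
        obtain ⟨p', hp', q', hq', hg⟩ := hg
        refine ⟨p + p', add_mem hp hp', q + q', add_mem hq hq', fun i => ?_⟩
        simp only [Pi.add_apply, map_add, hf, hg, extend_add]
        ring
      | smul φ f _ hf =>
        obtain ⟨p, hp, q, hq, hf⟩ := hf
        obtain ⟨u, w, huw⟩ := exists_even_add_odd s (toReal F φ)
        have h2 : (T (1 + 1) : ℝ[T;T⁻¹]) = substSq s (T s.sgn) := by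
          rw [substSq_T]
          cases s <;> simp [Side.sgn]
        rw [LaurentPolynomial.T_add] at h2
        refine ⟨u • p + (T s.sgn * w) • q,
          add_mem (Submodule.smul_mem _ _ hp) (Submodule.smul_mem _ _ hq),
          u • q + w • p, add_mem (Submodule.smul_mem _ _ hq) (Submodule.smul_mem _ _ hp),
          fun i => ?_⟩
        simp only [Pi.smul_apply, smul_eq_mul, map_mul, huw, hf, extend_add, extend_smul,
          Pi.add_apply, ← h2]
        ring
    exact hasSolution_of_leadPos hp hq fun i => hpq i ▸ leadPos_toReal (hpos i)

end Subfield

end LaurentDecision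

namespace LaurentDecision

/-! ### Integer arithmetic is primitive recursive. -/

section IntComputable

theorem encode_ofNat (m : ℕ) : Encodable.encode (Int.ofNat m) = 2 * m := rfl

theorem encode_negSucc (m : ℕ) : Encodable.encode (Int.negSucc m) = 2 * m + 1 := rfl

theorem primrec_toNat : Primrec Int.toNat :=
  (Primrec.cond (Primrec.nat_bodd.comp Primrec.encode) (Primrec.const 0)
    (Primrec.nat_div2.comp Primrec.encode)).of_eq fun n => by
      cases n with
      | ofNat m => rw [encode_ofNat]; simp [Nat.div2_val]
      | negSucc m => rw [encode_negSucc]; simp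

theorem primrec_toNat_neg : Primrec fun n : ℤ => (-n).toNat :=
  (Primrec.cond (Primrec.nat_bodd.comp Primrec.encode)
    (Primrec.succ.comp (Primrec.nat_div2.comp Primrec.encode)) (Primrec.const 0)).of_eq fun n => by
      cases n with
      | ofNat m => rw [encode_ofNat]; simp
      | negSucc m => rw [encode_negSucc]; simp [Nat.div2_val]

theorem primrec_natCast_sub_natCast : Primrec fun p : ℕ × ℕ => (p.1 : ℤ) - p.2 := by
  refine Primrec.encode_iff.1 ((Primrec.ite (Primrec.nat_le.comp Primrec.snd Primrec.fst)
    (Primrec.nat_mul.comp (Primrec.const 2) (Primrec.nat_sub.comp Primrec.fst Primrec.snd))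
    -- For `p < q` the difference is `Int.negSucc (q - p - 1)`, whose code is `2 * (q - p) - 1`.
    (Primrec.pred.comp (Primrec.nat_mul.comp (Primrec.const 2)
      (Primrec.nat_sub.comp Primrec.snd Primrec.fst)))).of_eq fun p => ?_)
  obtain ⟨p, q⟩ := p
  dsimp only
  split_ifs with h
  · obtain ⟨m, rfl⟩ := Nat.exists_eq_add_of_le h
    rw [show ((q + m : ℕ) : ℤ) - q = Int.ofNat m by simp]
    change 2 * (q + m - q) = 2 * m
    rw [Nat.add_sub_cancel_left]
  · obtain ⟨m, rfl⟩ := Nat.exists_eq_add_of_lt (not_le.1 h)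
    rw [show (p : ℤ) - (p + m + 1 : ℕ) = Int.negSucc m by rw [Int.negSucc_eq]; push_cast; ring]
    change _ = 2 * m + 1
    simp only [Nat.pred_eq_sub_one]
    omega

theorem primrec_int_add : Primrec₂ fun x y : ℤ => x + y :=
  (primrec_natCast_sub_natCast.comp (Primrec.pair
    (Primrec.nat_add.comp (primrec_toNat.comp Primrec.fst) (primrec_toNat.comp Primrec.snd))
    (Primrec.nat_add.comp (primrec_toNat_neg.comp Primrec.fst)
      (primrec_toNat_neg.comp Primrec.snd)))).of_eq fun p => by dsimp only; omega

theorem primrec_int_neg : Primrec fun x : ℤ => -x :=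
  (primrec_natCast_sub_natCast.comp (Primrec.pair primrec_toNat_neg primrec_toNat)).of_eq
    fun p => by dsimp only; omega

theorem primrec_int_le : PrimrecRel fun x y : ℤ => x ≤ y :=
  (Primrec.nat_le.comp
    (Primrec.nat_add.comp (primrec_toNat.comp Primrec.fst) (primrec_toNat_neg.comp Primrec.snd))
    (Primrec.nat_add.comp (primrec_toNat.comp Primrec.snd)
      (primrec_toNat_neg.comp Primrec.fst))).of_eq fun p => by dsimp only; omega

end IntComputable

/-! ### Computable list operations and decision by certificates. -/

section ListComputable

variable {α β σ : Type*} [Primcodable α] [Primcodable β] [Primcodable σ]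

theorem computable_foldl {f : α → List β} {g : α → σ} {h : α → σ × β → σ} (hf : Computable f)
    (hg : Computable g) (hh : Computable₂ h) :
    Computable fun a => (f a).foldl (fun s b => h a (s, b)) (g a) := by
  -- The fold is a recursion on the number of entries consumed, each read by its index; below the
  -- length of the list the `none` branch never occurs.
  have hstep : Computable₂ fun (a : α) (p : ℕ × σ) =>
      Option.casesOn (motive := fun _ => σ) ((f a)[p.1]?) p.2 fun b => h a (p.2, b) :=
    Computable.option_casesOn
      (Computable.list_getElem?.comp (hf.comp Computable.fst)
        (Computable.fst.comp Computable.snd))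
      (Computable.snd.comp Computable.snd)
      (hh.comp (Computable.fst.comp Computable.fst)
        (Computable.pair (Computable.snd.comp (Computable.snd.comp Computable.fst)) Computable.snd))
  refine (Computable.nat_rec (Computable.list_length.comp hf) hg hstep).of_eq fun a => ?_
  have key : ∀ n, n ≤ (f a).length →
      (Nat.rec (motive := fun _ => σ) (g a) (fun y IH =>
        Option.casesOn (motive := fun _ => σ) ((f a)[y]?) IH fun b => h a (IH, b)) n) =
        ((f a).take n).foldl (fun s b => h a (s, b)) (g a) := by
    intro n
    induction n with
    | zero => simp
    | succ n ih =>
      intro hn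
      have hlt : n < (f a).length := hn
      rw [List.take_add_one, List.foldl_append, ← ih hlt.le]
      simp [List.getElem?_eq_getElem hlt]
  simpa using key _ le_rfl

theorem computable_flatMap {f : α → List β} {g : α → β → List σ} (hf : Computable f)
    (hg : Computable₂ g) : Computable fun a => (f a).flatMap (g a) := by
  refine (computable_foldl hf (Computable.const []) (h := fun a p => p.1 ++ g a p.2)
    (Computable.list_append.comp (Computable.fst.comp Computable.snd)
      (hg.comp Computable.fst (Computable.snd.comp Computable.snd)))).of_eq fun a => ?_
  exact List.flatMap_eq_foldl.symm

theorem computable_map {f : α → List β} {g : α → β → σ} (hf : Computable f)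
    (hg : Computable₂ g) : Computable fun a => (f a).map (g a) :=
  (computable_flatMap hf (g := fun a b => [g a b])
    (Computable.list_cons.comp hg (Computable.const []))).of_eq fun a => by
      exact List.map_eq_flatMap.symm

theorem computable_all {f : α → List β} {g : α → β → Bool} (hf : Computable f)
    (hg : Computable₂ g) : Computable fun a => (f a).all (g a) := by
  refine (computable_foldl hf (Computable.const true) (h := fun a p => p.1 && g a p.2)
    (Primrec.and.to_comp.comp (Computable.fst.comp Computable.snd)
      (hg.comp Computable.fst (Computable.snd.comp Computable.snd)))).of_eq fun a => ?_
  have : ∀ (l : List β) (b : Bool), l.foldl (fun s x => s && g a x) b = (b && l.all (g a)) := by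
    intro l
    induction l with
    | nil => simp
    | cons x l ih => simp [ih, Bool.and_assoc]
  simp [this]

theorem computable_any {f : α → List β} {g : α → β → Bool} (hf : Computable f)
    (hg : Computable₂ g) : Computable fun a => (f a).any (g a) :=
  (Primrec.not.to_comp.comp (computable_all hf (g := fun a b => !g a b)
    (Primrec.not.to_comp.comp hg))).of_eq fun a => by simp [List.all_eq_not_any_not]

theorem computable_getD {f : α → List β} {g : α → ℕ} (d : β) (hf : Computable f)
    (hg : Computable g) : Computable fun a => (f a).getD (g a) d :=
  (Primrec.list_getD d).to_comp.comp hf hg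

/-- Search through all codes, skipping those that decode to nothing; the search halts exactly when a
witness exists. -/
theorem rePred_exists {A : α → β → Bool} (hA : Computable₂ A) : REPred fun x => ∃ w, A x w := by
  have h1 : Computable₂ fun (x : α) (n : ℕ) =>
      (Encodable.decode (α := β) n).bind fun w => bif A x w then some () else none :=
    Computable.option_bind (Computable.decode.comp Computable.snd)
      (Computable.cond (hA.comp (Computable.fst.comp Computable.fst) Computable.snd)
        (Computable.const (some ())) (Computable.const none))
  refine (Partrec.rfindOpt h1).dom_re.of_eq fun x => ?_
  rw [Nat.rfindOpt_dom]
  constructor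
  · rintro ⟨n, u, h⟩
    simp only [Option.mem_def, Option.bind_eq_some_iff] at h
    obtain ⟨w, -, h⟩ := h
    refine ⟨w, ?_⟩
    cases hw : A x w
    · simp [hw] at h
    · rfl
  · rintro ⟨w, hw⟩
    exact ⟨Encodable.encode w, (), by simp [hw]⟩

/-- A predicate is decidable if it and its negation have computably checkable certificates. -/
theorem computablePred_of_certificates {p : α → Prop} {A : α → β → Bool} {B : α → σ → Bool}
    (hA : Computable₂ A) (hB : Computable₂ B) (hp : ∀ x, p x ↔ ∃ w, A x w)
    (hn : ∀ x, ¬ p x ↔ ∃ w, B x w) : ComputablePred p :=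
  ComputablePred.computable_iff_re_compl_re'.2
    ⟨(rePred_exists hA).of_eq fun x => (hp x).symm, (rePred_exists hB).of_eq fun x => (hn x).symm⟩

end ListComputable

end LaurentDecision

namespace LaurentDecision

/-! ### Certificate checks on written polynomials. -/

/-- Operations on names: addition, negation, multiplication, comparison, and names of `0`
and `1`. -/
structure NameOps where
  add : ℕ × ℕ → ℕ
  neg : ℕ → ℕ
  mul : ℕ × ℕ → ℕ
  le : ℕ × ℕ → Bool
  zero : ℕ
  one : ℕ

namespace NameOps

variable (o : NameOps)

/-- A name of the coefficient of `c` at the exponent `e`. -/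
def coeff (c : PolyCode) (e : ℤ) : ℕ :=
  c.foldl (fun x t => bif t.1 = e then o.add (x, t.2) else x) o.zero

/-- Test whether a name denotes `0`. -/
def isZero (x : ℕ) : Bool := o.le (x, o.zero) && o.le (o.zero, x)

/-- Test whether a written Laurent polynomial is `0`. -/
def polyIsZero (c : PolyCode) : Bool := c.all fun t => o.isZero (o.coeff c t.1)

/-- Test whether a written Laurent polynomial has positive leading coefficient. -/
def polyLeadPos (c : PolyCode) : Bool :=
  c.any fun t => !o.le (o.coeff c t.1, o.zero) &&
    c.all fun u => decide (u.1 ≤ t.1) || o.isZero (o.coeff c u.1)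

/-- The product of written Laurent polynomials. -/
def polyMul (p q : PolyCode) : PolyCode :=
  p.flatMap fun t => q.map fun u => (t.1 + u.1, o.mul (t.2, u.2))

/-- The `i`-th coordinate of a written linear combination `w` of the tuples `H`. -/
def combination (H : List VecCode) (w : List (PolyCode × ℕ)) (i : ℕ) : PolyCode :=
  w.flatMap fun t => o.polyMul t.1 ((H.getD t.2 []).getD i [])

/-- Test whether all coordinates of a linear combination have positive leading coefficient. -/
def checkPos (x : ℕ × List VecCode) (w : List (PolyCode × ℕ)) : Bool :=
  (List.range x.1).all fun i => o.polyLeadPos (o.combination x.2 w i)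

/-- Test whether `y` is a nonzero tuple of nonnegative Laurent polynomials that is
orthogonal to the given tuples. -/
def checkRelation (x : ℕ × List VecCode) (y : VecCode) : Bool :=
  ((List.range x.1).all fun i => o.polyIsZero (y.getD i []) || o.polyLeadPos (y.getD i [])) &&
  (((List.range x.1).any fun i => o.polyLeadPos (y.getD i [])) &&
  x.2.all fun v =>
    o.polyIsZero ((List.range x.1).flatMap fun i => o.polyMul (y.getD i []) (v.getD i [])))

/-- The written form of `substSq`. -/
def polySubst (s : Side) (c : PolyCode) : PolyCode := c.map fun t => (s.sgn * t.1 + s.sgn * t.1, t.2)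

/-- The written form of `extend`. -/
def vecExtend (s : Side) (a : ℤ) (v : VecCode) : VecCode :=
  (((polySubst s (v.getD (s.large (k := 0)) [])).map fun t => (t.1 + (a + a + 1), t.2)) ++
    ((polySubst s (v.getD (s.small (k := 0)) [])).map fun t => (t.1, o.neg t.2))) ::
    v.map (polySubst s)

/-- All operations on names are computable. -/
structure IsComputable (o : NameOps) : Prop where
  add : Computable o.add
  neg : Computable o.neg
  mul : Computable o.mul
  le : Computable o.le

/-! ### Computability of the checks. -/

section Computable

variable {o : NameOps} (ho : o.IsComputable)
include ho

open Computable in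
theorem computable_coeff : Computable₂ o.coeff :=
  computable_foldl (f := fun p : PolyCode × ℤ => p.1) (g := fun _ => o.zero)
    (h := fun p q => bif decide (q.2.1 = p.2) then o.add (q.1, q.2.2) else q.1) fst (const o.zero)
    (Computable.cond
      (((Primrec.eq (α := ℤ)).decide.to_comp).comp (fst.comp (snd.comp snd)) (snd.comp fst))
      (ho.add.comp (pair (fst.comp snd) (snd.comp (snd.comp snd)))) (fst.comp snd))

open Computable in
theorem computable_isZero : Computable o.isZero :=
  Primrec.and.to_comp.comp (ho.le.comp (pair Computable.id (const o.zero)))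
    (ho.le.comp (pair (const o.zero) Computable.id))

open Computable in
theorem computable_polyIsZero : Computable o.polyIsZero :=
  computable_all Computable.id
    (g := fun (c : PolyCode) (t : ℤ × ℕ) => o.isZero (o.coeff c t.1))
    ((computable_isZero ho).comp ((computable_coeff ho).comp fst (fst.comp snd)))

open Computable in
theorem computable_polyLeadPos : Computable o.polyLeadPos :=
  computable_any Computable.id
    (g := fun (c : PolyCode) (t : ℤ × ℕ) => !o.le (o.coeff c t.1, o.zero) &&
      c.all fun u => decide (u.1 ≤ t.1) || o.isZero (o.coeff c u.1))
    (Primrec.and.to_comp.comp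
      (Primrec.not.to_comp.comp
        (ho.le.comp (pair ((computable_coeff ho).comp fst (fst.comp snd)) (const o.zero))))
      (computable_all (f := fun p : PolyCode × (ℤ × ℕ) => p.1)
        (g := fun p u => decide (u.1 ≤ p.2.1) || o.isZero (o.coeff p.1 u.1)) fst
        (Primrec.or.to_comp.comp
          (primrec_int_le.decide.to_comp.comp (fst.comp snd) (fst.comp (snd.comp fst)))
          ((computable_isZero ho).comp
            ((computable_coeff ho).comp (fst.comp fst) (fst.comp snd))))))

open Computable in
theorem computable_polyMul : Computable₂ o.polyMul :=
  computable_flatMap (f := fun p : PolyCode × PolyCode => p.1)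
    (g := fun p t => p.2.map fun u => (t.1 + u.1, o.mul (t.2, u.2))) fst
    (computable_map (f := fun q : (PolyCode × PolyCode) × (ℤ × ℕ) => q.1.2)
      (g := fun q u => (q.2.1 + u.1, o.mul (q.2.2, u.2))) (snd.comp fst)
      (pair (primrec_int_add.to_comp.comp (fst.comp (snd.comp fst)) (fst.comp snd))
        (ho.mul.comp (pair (snd.comp (snd.comp fst)) (snd.comp snd)))))

open Computable in
theorem computable_combination {γ : Type*} [Primcodable γ] {H : γ → List VecCode}
    {w : γ → List (PolyCode × ℕ)} {i : γ → ℕ} (hH : Computable H) (hw : Computable w)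
    (hi : Computable i) : Computable fun x => o.combination (H x) (w x) (i x) :=
  computable_flatMap (f := w)
    (g := fun x t => o.polyMul t.1 (((H x).getD t.2 []).getD (i x) [])) hw
    ((computable_polyMul ho).comp (fst.comp snd)
      (computable_getD [] (computable_getD [] (hH.comp fst) (snd.comp snd)) (hi.comp fst)))

open Computable in
theorem computable_checkPos : Computable₂ o.checkPos :=
  computable_all (f := fun p : (ℕ × List VecCode) × List (PolyCode × ℕ) => List.range p.1.1)
    (g := fun p i => o.polyLeadPos (o.combination p.1.2 p.2 i))
    (Primrec.list_range.to_comp.comp (fst.comp fst))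
    ((computable_polyLeadPos ho).comp
      (computable_combination ho (snd.comp (fst.comp fst)) (snd.comp fst) snd))

open Computable in
theorem computable_checkRelation : Computable₂ o.checkRelation := by
  have hr : Computable fun p : (ℕ × List VecCode) × VecCode => List.range p.1.1 :=
    Primrec.list_range.to_comp.comp (fst.comp fst)
  have hy : Computable fun q : ((ℕ × List VecCode) × VecCode) × ℕ => q.1.2.getD q.2 [] :=
    computable_getD [] (snd.comp fst) snd
  have h1 : Computable fun p : (ℕ × List VecCode) × VecCode => (List.range p.1.1).all
      fun i => o.polyIsZero (p.2.getD i []) || o.polyLeadPos (p.2.getD i []) :=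
    computable_all (f := fun p : (ℕ × List VecCode) × VecCode => List.range p.1.1)
      (g := fun p i => o.polyIsZero (p.2.getD i []) || o.polyLeadPos (p.2.getD i [])) hr
      (Primrec.or.to_comp.comp ((computable_polyIsZero ho).comp hy)
        ((computable_polyLeadPos ho).comp hy))
  have h2 : Computable fun p : (ℕ × List VecCode) × VecCode => (List.range p.1.1).any
      fun i => o.polyLeadPos (p.2.getD i []) :=
    computable_any (f := fun p : (ℕ × List VecCode) × VecCode => List.range p.1.1)
      (g := fun p i => o.polyLeadPos (p.2.getD i [])) hr
      ((computable_polyLeadPos ho).comp hy)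
  have h3 : Computable fun q : ((ℕ × List VecCode) × VecCode) × VecCode =>
      (List.range q.1.1.1).flatMap fun i => o.polyMul (q.1.2.getD i []) (q.2.getD i []) :=
    computable_flatMap
      (f := fun q : ((ℕ × List VecCode) × VecCode) × VecCode => List.range q.1.1.1)
      (g := fun q i => o.polyMul (q.1.2.getD i []) (q.2.getD i [])) (hr.comp fst)
      ((computable_polyMul ho).comp (computable_getD [] (snd.comp (fst.comp fst)) snd)
        (computable_getD [] (snd.comp fst) snd))
  have h4 : Computable fun p : (ℕ × List VecCode) × VecCode => p.1.2.all fun v =>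
      o.polyIsZero ((List.range p.1.1).flatMap fun i => o.polyMul (p.2.getD i []) (v.getD i [])) :=
    computable_all (f := fun p : (ℕ × List VecCode) × VecCode => p.1.2)
      (g := fun p v => o.polyIsZero
        ((List.range p.1.1).flatMap fun i => o.polyMul (p.2.getD i []) (v.getD i [])))
      (snd.comp fst)
      ((computable_polyIsZero ho).comp h3)
  exact Primrec.and.to_comp.comp h1 (Primrec.and.to_comp.comp h2 h4)

omit ho in
open Computable in
theorem computable_polySubst (s : Side) : Computable (polySubst s) := by
  have hs : Computable fun x : ℤ => s.sgn * x := by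
    cases s with
    | pos => exact Computable.id.of_eq fun x => by simp [Side.sgn]
    | neg => exact primrec_int_neg.to_comp.of_eq fun x => by simp [Side.sgn]
  have h1 : Computable₂ fun (_ : PolyCode) (t : ℤ × ℕ) => s.sgn * t.1 := hs.comp (fst.comp snd)
  exact computable_map Computable.id
    (g := fun (_ : PolyCode) (t : ℤ × ℕ) => (s.sgn * t.1 + s.sgn * t.1, t.2))
    (pair (primrec_int_add.to_comp.comp h1 h1) (snd.comp snd))

open Computable in
theorem computable_vecExtend (s : Side) : Computable₂ (o.vecExtend s) :=
  have h (j : ℕ) : Computable fun p : ℤ × VecCode => polySubst s (p.2.getD j []) :=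
    (computable_polySubst s).comp (computable_getD [] snd (const j))
  list_cons.comp
    (list_append.comp
      (computable_map (f := fun p : ℤ × VecCode => polySubst s (p.2.getD (s.large (k := 0)) []))
        (g := fun p t => (t.1 + (p.1 + p.1 + 1), t.2)) (h _)
        (pair
          (primrec_int_add.to_comp.comp (fst.comp snd)
            (primrec_int_add.to_comp.comp
              (primrec_int_add.to_comp.comp (fst.comp fst) (fst.comp fst)) (const 1)))
          (snd.comp snd)))
      (computable_map (f := fun p : ℤ × VecCode => polySubst s (p.2.getD (s.small (k := 0)) []))
        (g := fun _ t => (t.1, o.neg t.2)) (h _)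
        (pair (fst.comp snd) (ho.neg.comp (snd.comp snd)))))
    (computable_map (f := fun p : ℤ × VecCode => p.2) (g := fun _ c => polySubst s c) snd
      ((computable_polySubst s).comp snd))

open Computable in
theorem computable_extendInput (s : Side) :
    Computable fun x : Input => (x.1 + 3, x.2.2.map (o.vecExtend s x.2.1)) :=
  pair (Primrec.nat_add.to_comp.comp fst (const 3))
    (computable_map (f := fun x : Input => x.2.2) (g := fun x v => o.vecExtend s x.2.1 v)
      (snd.comp snd) ((computable_vecExtend ho s).comp (fst.comp (snd.comp fst)) snd))

end Computable

end NameOps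

end LaurentDecision

namespace LaurentDecision

/-! ### Correctness of the checks. -/

open LaurentPolynomial (C T)

variable {F : Subfield ℝ} {ν : ℕ → F}

/-- The Laurent polynomial over `F` with the listed terms. -/
noncomputable def polyOver (ν : ℕ → F) (c : PolyCode) : F[T;T⁻¹] :=
  (c.map fun t => C (ν t.2) * T t.1).sum

/-- The tuple over `F` with the listed coordinates. -/
noncomputable def vecOver (ν : ℕ → F) (N : ℕ) (v : VecCode) : Fin N → F[T;T⁻¹] :=
  fun i => polyOver ν (v.getD i [])

theorem polyOver_nil : polyOver ν [] = 0 := rfl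

theorem polyOver_cons (t : ℤ × ℕ) (c : PolyCode) :
    polyOver ν (t :: c) = C (ν t.2) * T t.1 + polyOver ν c := by
  simp [polyOver]

theorem polyOver_append (c d : PolyCode) : polyOver ν (c ++ d) = polyOver ν c + polyOver ν d := by
  simp [polyOver]

theorem polyOver_flatMap {β : Type*} (l : List β) (g : β → PolyCode) :
    polyOver ν (l.flatMap g) = (l.map fun b => polyOver ν (g b)).sum := by
  induction l with
  | nil => simp [polyOver_nil]
  | cons b l ih => simp [polyOver_append, ih]

theorem exists_polyOver_eq (hν : Function.Surjective ν) (f : F[T;T⁻¹]) : ∃ c, polyOver ν c = f := by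
  induction f using LaurentPolynomial.induction_on' with
  | add f g hf hg =>
    obtain ⟨c, rfl⟩ := hf
    obtain ⟨d, rfl⟩ := hg
    exact ⟨c ++ d, polyOver_append c d⟩
  | C_mul_T n a =>
    obtain ⟨x, rfl⟩ := hν a
    exact ⟨[(n, x)], by simp [polyOver]⟩

theorem toReal_C_mul_T (a : F) (n : ℤ) : toReal F (C a * T n) = C (a : ℝ) * T n := by
  rw [← LaurentPolynomial.single_eq_C_mul_T, ← LaurentPolynomial.single_eq_C_mul_T]
  exact AddMonoidAlgebra.mapRingHom_single _ _ _

theorem toReal_polyOver (c : PolyCode) : toReal F (polyOver ν c) = polyOf ν c := by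
  induction c with
  | nil => simp [polyOver, polyOf]
  | cons t c ih =>
    rw [polyOver_cons, map_add, ih, toReal_C_mul_T]
    simp [polyOf]

theorem coeff_polyOver_cons (t : ℤ × ℕ) (c : PolyCode) (e : ℤ) :
    (polyOver ν (t :: c)).coeff e = (if t.1 = e then ν t.2 else 0) + (polyOver ν c).coeff e := by
  rw [polyOver_cons, ← LaurentPolynomial.single_eq_C_mul_T, AddMonoidAlgebra.coeff_add,
    Finsupp.add_apply, AddMonoidAlgebra.coeff_single, Finsupp.single_apply]

/-- This is why the tests need to inspect only the exponents that are listed. -/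
theorem exists_mem_of_coeff_ne_zero {c : PolyCode} {e : ℤ} (h : (polyOver ν c).coeff e ≠ 0) :
    ∃ t ∈ c, t.1 = e := by
  induction c with
  | nil => simp [polyOver_nil] at h
  | cons t c ih =>
    by_cases ht : t.1 = e
    · exact ⟨t, by simp, ht⟩
    · obtain ⟨u, hu, he⟩ := ih (by simpa [coeff_polyOver_cons, ht] using h)
      exact ⟨u, by simp [hu], he⟩

/-- The operations on names represent those of `F`. -/
structure NameOps.Represents (o : NameOps) (ν : ℕ → F) : Prop where
  add : ∀ x y, ν (o.add (x, y)) = ν x + ν y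
  neg : ∀ x, ν (o.neg x) = -ν x
  mul : ∀ x y, ν (o.mul (x, y)) = ν x * ν y
  le : ∀ x y, o.le (x, y) = true ↔ ν x ≤ ν y
  zero : ν o.zero = 0
  one : ν o.one = 1

theorem IsComputableNumbering.exists_nameOps (hν : IsComputableNumbering F ν) :
    ∃ o : NameOps, o.IsComputable ∧ o.Represents ν := by
  obtain ⟨add, hadd, hadd'⟩ := hν.add
  obtain ⟨neg, hneg, hneg'⟩ := hν.neg
  obtain ⟨mul, hmul, hmul'⟩ := hν.mul
  obtain ⟨_, hle⟩ := hν.le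
  obtain ⟨z, hz⟩ := hν.surjective 0
  obtain ⟨u, hu⟩ := hν.surjective 1
  exact ⟨⟨add, neg, mul, fun p => decide (ν p.1 ≤ ν p.2), z, u⟩, ⟨hadd, hneg, hmul, hle⟩,
    ⟨hadd', hneg', hmul', fun x y => by simp, hz, hu⟩⟩

namespace NameOps

variable {o : NameOps} (ho : o.Represents ν)
include ho

theorem name_coeff (c : PolyCode) (e : ℤ) : ν (o.coeff c e) = (polyOver ν c).coeff e := by
  have key : ∀ x, ν (c.foldl (fun x t => bif t.1 = e then o.add (x, t.2) else x) x) =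
      ν x + (polyOver ν c).coeff e := by
    induction c with
    | nil => simp [polyOver_nil]
    | cons t c ih =>
      intro x
      rw [List.foldl_cons, ih, coeff_polyOver_cons]
      by_cases ht : t.1 = e
      · simp [ht, ho.add, add_assoc]
      · simp [ht]
  rw [coeff, key, ho.zero, zero_add]

theorem isZero_iff (x : ℕ) : o.isZero x = true ↔ ν x = 0 := by
  rw [isZero, Bool.and_eq_true, ho.le, ho.le, ho.zero, le_antisymm_iff]

theorem polyIsZero_iff (c : PolyCode) : o.polyIsZero c = true ↔ polyOver ν c = 0 := by
  simp only [polyIsZero, List.all_eq_true, isZero_iff ho, name_coeff ho]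
  constructor
  · intro h
    ext e
    by_contra hne
    obtain ⟨t, ht, rfl⟩ := exists_mem_of_coeff_ne_zero (ν := ν) (c := c) (e := e)
      (by simpa using hne)
    exact hne (by simp [h t ht])
  · intro h
    simp [h]

theorem polyLeadPos_iff (c : PolyCode) : o.polyLeadPos c = true ↔ LeadPos (polyOver ν c) := by
  have hle : ∀ x, (!o.le (x, o.zero)) = true ↔ 0 < ν x := fun x => by
    rw [Bool.not_eq_true', ← Bool.not_eq_true, ho.le, ho.zero, not_le]
  simp only [polyLeadPos, List.any_eq_true, Bool.and_eq_true, List.all_eq_true, Bool.or_eq_true,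
    decide_eq_true_eq, isZero_iff ho, name_coeff ho, hle]
  constructor
  · rintro ⟨t, -, hpos, h⟩
    refine ⟨t.1, hpos, fun e he => ?_⟩
    by_contra hne
    obtain ⟨u, hu, rfl⟩ := exists_mem_of_coeff_ne_zero hne
    rcases h u hu with h | h
    · exact he.not_ge h
    · exact hne h
  · rintro ⟨d, hpos, h⟩
    obtain ⟨t, ht, rfl⟩ := exists_mem_of_coeff_ne_zero hpos.ne'
    exact ⟨t, ht, hpos, fun u _ => (le_or_gt u.1 t.1).imp id (h u.1)⟩

theorem polyOver_polyMul (p q : PolyCode) :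
    polyOver ν (o.polyMul p q) = polyOver ν p * polyOver ν q := by
  have h : ∀ t : ℤ × ℕ, polyOver ν (q.map fun u => (t.1 + u.1, o.mul (t.2, u.2))) =
      C (ν t.2) * T t.1 * polyOver ν q := fun t => by
    induction q with
    | nil => simp [polyOver_nil]
    | cons u q ih =>
      rw [List.map_cons, polyOver_cons, ih, polyOver_cons, ho.mul, map_mul, LaurentPolynomial.T_add]
      ring
  rw [polyMul, polyOver_flatMap]
  simp only [h, List.sum_map_mul_right]
  rfl

theorem polyOver_combination (H : List VecCode) (w : List (PolyCode × ℕ)) (i : ℕ) :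
    polyOver ν (o.combination H w i) =
      (w.map fun t => polyOver ν t.1 * polyOver ν ((H.getD t.2 []).getD i [])).sum := by
  simp only [combination, polyOver_flatMap, polyOver_polyMul ho]

theorem mem_span_iff (hν : Function.Surjective ν) {N : ℕ} (H : List VecCode)
    (f : Fin N → F[T;T⁻¹]) :
    f ∈ Submodule.span F[T;T⁻¹] {g | ∃ v ∈ H, vecOver ν N v = g} ↔
      ∃ w, ∀ i : Fin N, polyOver ν (o.combination H w i) = f i := by
  simp only [polyOver_combination ho]
  constructor
  · intro hf
    induction hf using Submodule.span_induction with
    | mem f hf =>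
      obtain ⟨v, hv, rfl⟩ := hf
      obtain ⟨j, hj, rfl⟩ := List.mem_iff_getElem.1 hv
      refine ⟨[([(0, o.one)], j)], fun i => ?_⟩
      simp [vecOver, polyOver, ho.one, hj]
    | zero => exact ⟨[], by simp⟩
    | add f g _ _ hf hg =>
      obtain ⟨w, hw⟩ := hf
      obtain ⟨w', hw'⟩ := hg
      exact ⟨w ++ w', fun i => by rw [List.map_append, List.sum_append, hw, hw']; rfl⟩
    | smul φ f _ hf =>
      obtain ⟨w, hw⟩ := hf
      obtain ⟨c, rfl⟩ := exists_polyOver_eq hν φ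
      refine ⟨w.map fun t => (o.polyMul c t.1, t.2), fun i => ?_⟩
      simp only [List.map_map, Function.comp_def, polyOver_polyMul ho, mul_assoc,
        List.sum_map_mul_left, hw]
      rfl
  · rintro ⟨w, hw⟩
    obtain rfl : f = (w.map fun t => polyOver ν t.1 • vecOver ν N (H.getD t.2 [])).sum := by
      funext i
      refine (hw i).symm.trans
        (Eq.trans ?_ (map_list_sum (Pi.evalAddMonoidHom (fun _ => F[T;T⁻¹]) i) _).symm)
      rw [List.map_map]
      rfl
    refine list_sum_mem fun g hg => ?_
    obtain ⟨t, -, rfl⟩ := List.mem_map.1 hg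
    refine Submodule.smul_mem _ _ ?_
    -- An index beyond the list refers to the empty code, which denotes the zero tuple and adds
    -- nothing to the span.
    by_cases ht : t.2 < H.length
    · exact Submodule.subset_span ⟨_, List.getD_eq_getElem (hn := ht) .. ▸ List.getElem_mem ht, rfl⟩
    · rw [List.getD_eq_default _ _ (not_lt.1 ht)]
      have : vecOver ν N [] = 0 := by
        funext i
        simp [vecOver, polyOver_nil]
      rw [this]
      exact zero_mem _

theorem exists_checkPos_iff (hν : Function.Surjective ν) (N : ℕ) (H : List VecCode) :
    (∃ f ∈ Submodule.span F[T;T⁻¹] {g | ∃ v ∈ H, vecOver ν N v = g}, ∀ i, LeadPos (f i)) ↔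
      ∃ w, o.checkPos (N, H) w = true := by
  simp only [checkPos, List.all_eq_true, List.mem_range, polyLeadPos_iff ho, mem_span_iff ho hν]
  constructor
  · rintro ⟨f, ⟨w, hw⟩, hf⟩
    exact ⟨w, fun i hi => hw ⟨i, hi⟩ ▸ hf ⟨i, hi⟩⟩
  · rintro ⟨w, hw⟩
    exact ⟨_, ⟨w, fun i => rfl⟩, fun i => hw i i.2⟩

theorem checkRelation_iff (N : ℕ) (H : List VecCode) (y : VecCode) :
    o.checkRelation (N, H) y = true ↔
      (∀ i, vecOver ν N y i = 0 ∨ LeadPos (vecOver ν N y i)) ∧ (∃ i, LeadPos (vecOver ν N y i)) ∧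
        ∀ v ∈ H, ∑ i, vecOver ν N y i * vecOver ν N v i = 0 := by
  have hsum : ∀ v : VecCode,
      polyOver ν ((List.range N).flatMap fun i => o.polyMul (y.getD i []) (v.getD i [])) =
        ∑ i, vecOver ν N y i * vecOver ν N v i := fun v => by
    simp only [polyOver_flatMap, polyOver_polyMul ho]
    exact Finset.sum_range fun i => polyOver ν (y.getD i []) * polyOver ν (v.getD i [])
  simp only [checkRelation, Bool.and_eq_true, List.all_eq_true, List.any_eq_true, List.mem_range,
    Bool.or_eq_true, polyLeadPos_iff ho, polyIsZero_iff ho, hsum, Fin.forall_iff, Fin.exists_iff,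
    vecOver, exists_prop]

/-- Gordan's alternative supplies the relation, and surjectivity of `ν` lets it be written down.
Conversely, orthogonality to the generators extends to their span. -/
theorem exists_checkRelation_iff (hν : Function.Surjective ν) (N : ℕ) (H : List VecCode) :
    (¬ ∃ f ∈ Submodule.span F[T;T⁻¹] {g | ∃ v ∈ H, vecOver ν N v = g}, ∀ i, LeadPos (f i)) ↔
      ∃ y, o.checkRelation (N, H) y = true := by
  simp only [checkRelation_iff ho]
  constructor
  · intro h
    obtain ⟨y, hy, hy', hrel⟩ := (exists_leadPos_or_exists_relation _).resolve_left h
    choose c hc using fun i => exists_polyOver_eq hν (y i)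
    obtain rfl : vecOver ν N (List.ofFn c) = y := by
      funext i
      simp [vecOver, hc]
    exact ⟨_, hy, hy', fun v hv => hrel _ (Submodule.subset_span ⟨v, hv, rfl⟩)⟩
  · rintro ⟨y, hy, hy', hrel⟩ ⟨f, hf, hpos⟩
    refine not_exists_leadPos_of_relation f _ hpos hy hy' ?_
    clear hpos
    induction hf using Submodule.span_induction with
    | mem f hf =>
      obtain ⟨v, hv, rfl⟩ := hf
      exact hrel v hv
    | zero => simp
    | add f g _ _ hf hg => simp [mul_add, Finset.sum_add_distrib, hf, hg]
    | smul φ f _ hf =>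
      simp only [Pi.smul_apply, smul_eq_mul, mul_left_comm _ φ]
      rw [← Finset.mul_sum, hf, mul_zero]

omit ho in
theorem toReal_polySubst (s : Side) (c : PolyCode) :
    toReal F (polyOver ν (polySubst s c)) = substSq s (polyOf ν c) := by
  rw [toReal_polyOver]
  induction c with
  | nil => simp [polySubst, polyOf]
  | cons t c ih =>
    simp only [polySubst, polyOf, List.map_cons, List.sum_cons, map_add, substSq_C_mul_T] at ih ⊢
    rw [ih, mul_assoc, two_mul]

omit ho in
theorem polyOver_shift (c : PolyCode) (n : ℤ) :
    polyOver ν (c.map fun t => (t.1 + n, t.2)) = T n * polyOver ν c := by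
  induction c with
  | nil => simp [polyOver_nil]
  | cons t c ih =>
    rw [List.map_cons, polyOver_cons, ih, polyOver_cons, LaurentPolynomial.T_add]
    ring

theorem polyOver_neg (c : PolyCode) :
    polyOver ν (c.map fun t => (t.1, o.neg t.2)) = -polyOver ν c := by
  induction c with
  | nil => simp [polyOver_nil]
  | cons t c ih =>
    rw [List.map_cons, polyOver_cons, ih, polyOver_cons, ho.neg, map_neg]
    ring

theorem toReal_vecOver_vecExtend (s : Side) (a : ℤ) (k : ℕ) (v : VecCode) (i : Fin (k + 3)) :
    toReal F (vecOver ν (k + 3) (o.vecExtend s a v) i) = extend s a (vecOf ν (k + 2) v) i := by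
  cases i using Fin.cases with
  | zero =>
    -- The written form reads the two coordinates by their numerical index, which does not depend on
    -- `k`.
    have h1 : ((s.large (k := 0) : Fin 2) : ℕ) = (s.large : Fin (k + 2)) := by cases s <;> rfl
    have h2 : ((s.small (k := 0) : Fin 2) : ℕ) = (s.small : Fin (k + 2)) := by cases s <;> rfl
    simp only [vecOver, vecExtend, Fin.val_zero, List.getD_cons_zero, polyOver_append,
      polyOver_neg ho, polyOver_shift, map_add, map_neg, map_mul, toReal_polySubst, extend_zero,
      vecOf, h1, h2]
    have hT : toReal F (T (a + a + 1)) = T (2 * a + 1) := by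
      have := toReal_C_mul_T (F := F) 1 (a + a + 1)
      simpa [two_mul] using this
    rw [hT, sub_eq_add_neg]
  | succ i =>
    simp only [vecOver, vecExtend, Fin.val_succ, List.getD_cons_succ, extend_succ, vecOf]
    rw [← toReal_polySubst]
    congr 2
    exact List.getD_map (f := polySubst s) (d := []) ..

end NameOps

end LaurentDecision

/-! ### The decision procedure. -/

theorem mainTheorem5 (s : LaurentDecision.Side) (F : Subfield ℝ) (ν : ℕ → F)
    (hν : LaurentDecision.IsComputableNumbering F ν) :
    ComputablePred fun x : LaurentDecision.Input =>
      LaurentDecision.HasSolution s x.2.1 (LaurentDecision.moduleOf ν (x.1 + 2) x.2.2) := by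
  obtain ⟨o, hoc, hor⟩ := hν.exists_nameOps
  obtain ⟨_, h⟩ := LaurentDecision.computablePred_of_certificates
    (LaurentDecision.NameOps.computable_checkPos hoc)
    (LaurentDecision.NameOps.computable_checkRelation hoc)
    (fun x => LaurentDecision.NameOps.exists_checkPos_iff hor hν.surjective x.1 x.2)
    (fun x => LaurentDecision.NameOps.exists_checkRelation_iff hor hν.surjective x.1 x.2)
  -- The positivity problem over `F` is decidable, and the original question reduces to it by the
  -- computable map that extends every generator.
  refine ComputablePred.of_eq
    ⟨fun _ => inferInstance, h.comp (LaurentDecision.NameOps.computable_extendInput hoc s)⟩ fun x => ?_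
  symm
  refine LaurentDecision.hasSolution_span_iff s x.2.1 _ _ ?_ ?_
  · rintro _ ⟨v', hv', rfl⟩
    obtain ⟨v, hv, rfl⟩ := List.mem_map.1 hv'
    exact ⟨_, ⟨v, hv, rfl⟩, LaurentDecision.NameOps.toReal_vecOver_vecExtend hor s x.2.1 x.1 v⟩
  · rintro _ ⟨v, hv, rfl⟩
    exact ⟨_, ⟨_, List.mem_map.2 ⟨v, hv, rfl⟩, rfl⟩,
      LaurentDecision.NameOps.toReal_vecOver_vecExtend hor s x.2.1 x.1 v⟩
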